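/- Let $U,T,U',T'$ be $\sigma$-finite measure spaces (receiving users, receive times, transmitting users, transmit times; for instance intervals with Lebesgue measure, or finite sets with counting measure), and let $k_H(u,t;u',t')$ be a complex-valued square-integrable kernel on $(U\times T)\times(U'\times T')$, with channel operator $$(Hx)(u,t)=\iint k_H(u,t;u',t')\,x(u',t')\,du'\,dt',\qquad x\in L^2(U'\times T').$$ Write $\langle a,b\rangle=\iint a\,b^*\,du\,dt$ and $\|a\|^2=\langle a,a\rangle$. A decomposition of $k_H$ consists of a finite or countably infinite index set, nonzero numbers $\sigma_n\in\mathbb C$ and orthonormal families $\{\psi_n\}\subset L^2(U\times T)$, $\{\phi_n\}\subset L^2(U'\times T')$ such that $$k_H(u,t;u',t')=\sum_n\sigma_n\,\psi_n(u,t)\,\phi_n(u',t')\quad\text{in }L^2 .$$ Then $k_H$ has such a decomposition, and for every such decomposition and every data signal $s\in L^2(U\times T)$, with $x_n=\langle s,\psi_n\rangle/\sigma_n$, the following hold. 1. If $s$ lies in the closed linear span of $\{\psi_n\}$ (for instance if $\{\psi_n\}$ is an orthonormal basis) and the series $x(u',t')=\sum_n x_n\,\phi_n^*(u',t')$ converges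 in $L^2(U'\times T')$, then the integral $(Hx)(u,t)$ converges absolutely for almost every $(u,t)$, and the precoded signal $x$ gives interference-free reception: $\|s-Hx\|^2=0$. 2. There is some $y\in L^2(U'\times T')$ with $\|s-Hy\|^2=0$ if and only if $s$ lies in the closed linear span of $\{\psi_n\}$ and the series $\sum_n x_n\phi_n^*$ converges in $L^2(U'\times T')$. 3. If $s$ lies in the closed linear span of $\{\psi_n\}$, then, whether or not that series converges, its partial sums (over finite sets $F$ of indices, ordered by inclusion) satisfy $\bigl\|s-H\sum_{n\in F}x_n\phi_n^*\bigr\|^2\to0$. -/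

import Mathlib

open MeasureTheory Filter Topology
open scoped ENNReal ComplexConjugate

noncomputable section

namespace Precoding

/-- The inner product `⟨a, b⟩ = ∫ a b^*`. -/
def ip {X : Type*} [MeasurableSpace X] (μ : Measure X) (a b : X → ℂ) : ℂ :=
  ∫ p, a p * conj (b p) ∂μ

/-- The squared norm `‖f‖² = ∫ |f|²`, with values in `[0, ∞]`. -/
def sqNorm {X : Type*} [MeasurableSpace X] (μ : Measure X) (f : X → ℂ) : ℝ≥0∞ :=
  ∫⁻ p, ‖f p‖ₑ ^ 2 ∂μ

/-- The series `∑ n, f n` converges (unconditionally) to `g` in the `L²` sense. -/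
def HasSumL2 {X ι : Type*} [MeasurableSpace X] (μ : Measure X) (f : ι → X → ℂ) (g : X → ℂ) :
    Prop :=
  Tendsto (fun F : Finset ι => sqNorm μ (fun p => g p - ∑ n ∈ F, f n p)) atTop (𝓝 0)

/-- `f` lies in the `L²`-closed linear span of the family `e`. -/
def InClosedSpan {X ι : Type*} [MeasurableSpace X] (μ : Measure X) (e : ι → X → ℂ)
    (f : X → ℂ) : Prop :=
  ∀ ε : ℝ≥0∞, 0 < ε →
    ∃ (F : Finset ι) (c : ι → ℂ), sqNorm μ (fun p => f p - ∑ n ∈ F, c n * e n p) < ε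

/-- `e` is an orthonormal family of square-integrable functions. -/
structure IsOrthonormal {X ι : Type*} [MeasurableSpace X] (μ : Measure X) (e : ι → X → ℂ) :
    Prop where
  memLp : ∀ n, MemLp (e n) 2 μ
  norm_one : ∀ n, ip μ (e n) (e n) = 1
  orthogonal : ∀ n m, n ≠ m → ip μ (e n) (e m) = 0

/-- The channel with kernel `k`: `(H x)(p) = ∫ k(p; q) x(q) dq`. -/
def channel {X Y : Type*} [MeasurableSpace Y] (ν : Measure Y) (k : X → Y → ℂ) (x : Y → ℂ) :
    X → ℂ :=
  fun p => ∫ q, k p q * x q ∂ν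

/-- `k(p; q) = ∑ n, σ n ψ n(p) φ n(q)` in `L²` of the product, with nonzero `σ n` and with
orthonormal families `ψ` and `φ`. -/
structure IsDecomposition {X Y ι : Type*} [MeasurableSpace X] [MeasurableSpace Y]
    (μ : Measure X) (ν : Measure Y) (k : X → Y → ℂ)
    (σ : ι → ℂ) (ψ : ι → X → ℂ) (φ : ι → Y → ℂ) : Prop where
  ne_zero : ∀ n, σ n ≠ 0
  orthonormal_out : IsOrthonormal μ ψ
  orthonormal_in : IsOrthonormal ν φ
  hasSum : HasSumL2 (μ.prod ν) (fun n (z : X × Y) => σ n * ψ n z.1 * φ n z.2)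
    (fun z => k z.1 z.2)

/-- The `n`-th term `x n φ n^*` of the precoded signal, where `x n = ⟨s, ψ n⟩ / σ n`. -/
def precodedTerm {X Y ι : Type*} [MeasurableSpace X] (μ : Measure X)
    (σ : ι → ℂ) (ψ : ι → X → ℂ) (φ : ι → Y → ℂ) (s : X → ℂ) (n : ι) : Y → ℂ :=
  fun q => ip μ s (ψ n) / σ n * conj (φ n q)

/-- `x` is square-integrable and `x = ∑ n, (⟨s, ψ n⟩ / σ n) φ n^*` in `L²`. -/
structure IsPrecoded {X Y ι : Type*} [MeasurableSpace X] [MeasurableSpace Y]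
    (μ : Measure X) (ν : Measure Y)
    (σ : ι → ℂ) (ψ : ι → X → ℂ) (φ : ι → Y → ℂ) (s : X → ℂ) (x : Y → ℂ) : Prop where
  memLp : MemLp x 2 ν
  hasSum : HasSumL2 ν (precodedTerm μ σ ψ φ s) x

end Precoding

end

/-!
Passing to classes in `L²`, a square-integrable kernel becomes a compact operator `A`, and a
decomposition of the kernel becomes a singular value expansion `A x = ∑ n, σ n ⟨e n, x⟩ ψ n` with
`e n = φ n^*`. Comparing coefficients along `ψ n`, the equation `A x = s` says that `s` lies in the
closed span of the `ψ n` and that `σ n ⟨e n, x⟩ = ⟨ψ n, s⟩`, which is Picard's criterion; since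
`A e n = σ n ψ n`, applying `A` to a partial sum of `∑ n, (⟨ψ n, s⟩ / σ n) e n` gives a partial sum
of the expansion of `s`, whether or not the former series converges.

For existence, the product kernels `a(p) b(q)^*` induce rank-one operators and span a dense
subspace, so `A` is compact, and the eigenvectors of `A* A` with nonzero eigenvalue form the family
`e n`.
The coefficient of the kernel along the orthonormal product kernel `ψ n ⊗ φ n` is `σ n`, so by
Bessel's inequality the singular expansion converges in `L²` as a series of kernels; its sum induces
`A` as well, and the operator determines the kernel.
-/

namespace Precoding

open scoped InnerProductSpace

section OrthonormalSeries

variable {𝕜 E ι : Type*} [RCLike 𝕜] [NormedAddCommGroup E] [InnerProductSpace 𝕜 E] {v : ι → E}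

theorem inner_eq_of_hasSum_smul (hv : Orthonormal 𝕜 v) {c : ι → 𝕜} {x : E}
    (hx : HasSum (fun i => c i • v i) x) (j : ι) : ⟪v j, x⟫_𝕜 = c j := by
  classical
  have hinner : HasSum (fun i => ⟪v j, c i • v i⟫_𝕜) ⟪v j, x⟫_𝕜 := hx.mapL (innerSL 𝕜 (v j))
  simp only [inner_smul_right, orthonormal_iff_ite.1 hv, mul_ite, mul_one, mul_zero] at hinner
  refine hinner.unique ?_
  simpa using hasSum_ite_eq j (c j) |>.congr_fun fun i => by grind

theorem mem_topologicalClosure_span_of_hasSum_smul {c : ι → 𝕜} {x : E}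
    (hx : HasSum (fun i => c i • v i) x) :
    x ∈ (Submodule.span 𝕜 (Set.range v)).topologicalClosure :=
  mem_closure_of_tendsto hx (Eventually.of_forall fun _ =>
    Submodule.sum_mem _ fun i _ => Submodule.smul_mem _ _ (Submodule.subset_span ⟨i, rfl⟩))

theorem mem_orthogonal_span_range_iff {x : E} :
    x ∈ (Submodule.span 𝕜 (Set.range v))ᗮ ↔ ∀ i, ⟪v i, x⟫_𝕜 = 0 := by
  rw [← Submodule.span_singleton_le_iff_mem, ← Submodule.isOrtho_iff_le, Submodule.isOrtho_comm,
    Submodule.isOrtho_span]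
  simp

variable [CompleteSpace E]

theorem summable_inner_smul (hv : Orthonormal 𝕜 v) (x : E) :
    Summable fun i => ⟪v i, x⟫_𝕜 • v i := by
  simpa using (hv.orthogonalFamily.summable_iff_norm_sq_summable _).2
    (hv.inner_products_summable x)

theorem exists_hasSum_inner_smul_inner_sub_eq_zero (hv : Orthonormal 𝕜 v) (x : E) :
    ∃ y, HasSum (fun i => ⟪v i, x⟫_𝕜 • v i) y ∧ ∀ i, ⟪v i, x - y⟫_𝕜 = 0 := by
  obtain ⟨y, hy⟩ := summable_inner_smul hv x
  refine ⟨y, hy, fun i => ?_⟩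
  rw [inner_sub_right, inner_eq_of_hasSum_smul hv hy, sub_self]

theorem hasSum_inner_smul_of_mem_topologicalClosure_span (hv : Orthonormal 𝕜 v) {x : E}
    (hx : x ∈ (Submodule.span 𝕜 (Set.range v)).topologicalClosure) :
    HasSum (fun i => ⟪v i, x⟫_𝕜 • v i) x := by
  obtain ⟨y, hy, horth⟩ := exists_hasSum_inner_smul_inner_sub_eq_zero hv x
  have hmem := Submodule.sub_mem _ hx (mem_topologicalClosure_span_of_hasSum_smul hy)
  rw [← mem_orthogonal_span_range_iff, ← Submodule.orthogonal_closure] at horth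
  have hxy : x - y = 0 := Submodule.disjoint_def.1 (Submodule.orthogonal_disjoint _) _ hmem horth
  rwa [← sub_eq_zero.1 hxy] at hy

end OrthonormalSeries

section SingularExpansion

universe u

variable {𝕜 : Type u} {E F ι κ : Type*} [RCLike 𝕜]
  [NormedAddCommGroup E] [InnerProductSpace 𝕜 E] [NormedAddCommGroup F] [InnerProductSpace 𝕜 F]
  {A : E →L[𝕜] F} {σ : ι → 𝕜} {f : ι → F} {e : ι → E}

/-- The singular value expansion `A x = ∑ n, σ n ⟨e n, x⟩ f n` of an operator between Hilbert
spaces, converging in norm for each `x`. The `σ n` are nonzero scalars and need not be positive;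
they are neither ordered nor required to be distinct. -/
structure IsSingularExpansion (A : E →L[𝕜] F) (σ : ι → 𝕜) (f : ι → F) (e : ι → E) : Prop where
  ne_zero : ∀ n, σ n ≠ 0
  orthonormal_left : Orthonormal 𝕜 f
  orthonormal_right : Orthonormal 𝕜 e
  hasSum : ∀ x, HasSum (fun n => (σ n * ⟪e n, x⟫_𝕜) • f n) (A x)

namespace IsSingularExpansion

theorem comp_equiv (h : IsSingularExpansion A σ f e) (v : κ ≃ ι) :
    IsSingularExpansion A (σ ∘ v) (f ∘ v) (e ∘ v) where
  ne_zero n := h.ne_zero (v n)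
  orthonormal_left := h.orthonormal_left.comp v v.injective
  orthonormal_right := h.orthonormal_right.comp v v.injective
  hasSum x := v.hasSum_iff.2 (h.hasSum x)

theorem inner_apply (h : IsSingularExpansion A σ f e) (n : ι) (x : E) :
    ⟪f n, A x⟫_𝕜 = σ n * ⟪e n, x⟫_𝕜 :=
  inner_eq_of_hasSum_smul h.orthonormal_left (h.hasSum x) n

theorem apply_right (h : IsSingularExpansion A σ f e) (n : ι) : A (e n) = σ n • f n := by
  classical
  refine (h.hasSum (e n)).unique ?_
  have hsingle := hasSum_single (f := fun i => (σ i * ⟪e i, e n⟫_𝕜) • f i) n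
    fun i hi => by rw [h.orthonormal_right.2 hi, mul_zero, zero_smul]
  simpa [h.orthonormal_right.1 n] using hsingle

theorem apply_mem_topologicalClosure_span (h : IsSingularExpansion A σ f e) (x : E) :
    A x ∈ (Submodule.span 𝕜 (Set.range f)).topologicalClosure :=
  mem_topologicalClosure_span_of_hasSum_smul (h.hasSum x)

theorem summable_inner_apply_div_smul [CompleteSpace E] (h : IsSingularExpansion A σ f e) (x : E) :
    Summable fun n => (⟪f n, A x⟫_𝕜 / σ n) • e n := by
  simpa only [h.inner_apply, mul_div_cancel_left₀ _ (h.ne_zero _)]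
    using summable_inner_smul h.orthonormal_right x

variable [CompleteSpace F] {s : F}

theorem apply_eq_of_hasSum_inner_div_smul (h : IsSingularExpansion A σ f e)
    (hs : s ∈ (Submodule.span 𝕜 (Set.range f)).topologicalClosure) {x : E}
    (hx : HasSum (fun n => (⟪f n, s⟫_𝕜 / σ n) • e n) x) : A x = s := by
  refine (h.hasSum x).unique ?_
  simpa only [inner_eq_of_hasSum_smul h.orthonormal_right hx, mul_div_cancel₀ _ (h.ne_zero _)]
    using hasSum_inner_smul_of_mem_topologicalClosure_span h.orthonormal_left hs

theorem hasSum_apply_inner_div_smul (h : IsSingularExpansion A σ f e)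
    (hs : s ∈ (Submodule.span 𝕜 (Set.range f)).topologicalClosure) :
    HasSum (fun n => A ((⟪f n, s⟫_𝕜 / σ n) • e n)) s := by
  simpa only [map_smul, h.apply_right, smul_smul, div_mul_cancel₀ _ (h.ne_zero _)]
    using hasSum_inner_smul_of_mem_topologicalClosure_span h.orthonormal_left hs

end IsSingularExpansion

variable [CompleteSpace E]

theorem isSingularExpansion_of_pairwise_inner_apply_eq_zero (he : Orthonormal 𝕜 e)
    (hne : ∀ n, A (e n) ≠ 0) (horth : Pairwise fun n m => ⟪A (e n), A (e m)⟫_𝕜 = 0)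
    (hker : ∀ x, (∀ n, ⟪e n, x⟫_𝕜 = 0) → A x = 0) :
    IsSingularExpansion A (fun n => (‖A (e n)‖ : 𝕜))
      (fun n => (‖A (e n)‖ : 𝕜)⁻¹ • A (e n)) e where
  ne_zero n := by simpa using hne n
  orthonormal_left :=
    ⟨fun n => norm_smul_inv_norm (hne n),
      fun n m hnm => by
        simp only [inner_smul_left, inner_smul_right, horth hnm, mul_zero]⟩
  orthonormal_right := he
  hasSum x := by
    obtain ⟨y, hy, hxy⟩ := exists_hasSum_inner_smul_inner_sub_eq_zero he x
    have hAxy : A x = A y := by rw [← sub_eq_zero, ← map_sub, hker _ hxy]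
    have hne' : ∀ n, (‖A (e n)‖ : 𝕜) ≠ 0 := fun n => by simpa using hne n
    rw [hAxy]
    convert hy.mapL A using 2 with n
    rw [map_smul, smul_smul, mul_right_comm, mul_inv_cancel₀ (hne' n), one_mul]

theorem exists_orthonormal_eigenvectors {S : E →L[𝕜] E} (hc : IsCompactOperator S)
    (hS : S.IsSymmetric) :
    ∃ (ι : Type u) (e : ι → E) (m : ι → 𝕜), Orthonormal 𝕜 e ∧ (∀ i, m i ≠ 0) ∧
      (∀ i, S (e i) = m i • e i) ∧ ∀ x, (∀ i, ⟪e i, x⟫_𝕜 = 0) → S x = 0 := by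
  let V := fun m : 𝕜 => Module.End.eigenspace (S : E →ₗ[𝕜] E) m
  have hfin : ∀ m : {m : 𝕜 // m ≠ 0}, FiniteDimensional 𝕜 (V m) := fun m =>
    ContinuousLinearMap.finite_dimensional_eigenspace hc m m.2
  let b := fun m : {m : 𝕜 // m ≠ 0} => stdOrthonormalBasis 𝕜 (V m)
  refine ⟨Σ m : {m : 𝕜 // m ≠ 0}, Fin (Module.finrank 𝕜 (V m)), fun i => b i.1 i.2,
    fun i => i.1, ?_, fun i => i.1.2, fun i => Module.End.mem_eigenspace_iff.1 (b i.1 i.2).2,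
    fun x hx => ?_⟩
  · exact (hS.orthogonalFamily_eigenspaces.comp Subtype.val_injective).orthonormal_sigma_orthonormal
      fun m => (b m).orthonormal
  have hV : ∀ m : 𝕜, m ≠ 0 → ∀ v ∈ V m, ⟪v, x⟫_𝕜 = 0 := by
    intro m hm v hv
    have hrepr := congrArg Subtype.val ((b ⟨m, hm⟩).sum_repr ⟨v, hv⟩)
    rw [Submodule.coe_sum] at hrepr
    rw [← show _ = v from hrepr, sum_inner]
    refine Finset.sum_eq_zero fun j _ => ?_
    rw [Submodule.coe_smul, inner_smul_left, hx ⟨⟨m, hm⟩, j⟩, mul_zero]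
  have hSx : S x ∈ (⨆ m, V m)ᗮ := by
    rw [← Submodule.iInf_orthogonal, Submodule.mem_iInf]
    intro m v hv
    have hsymm : ⟪v, S x⟫_𝕜 = ⟪m • v, x⟫_𝕜 := by
      rw [← Module.End.mem_eigenspace_iff.1 hv]
      exact (hS v x).symm
    rw [hsymm, inner_smul_left]
    obtain rfl | hm := eq_or_ne m 0
    · rw [map_zero, zero_mul]
    · rw [hV m hm v hv, mul_zero]
  rw [ContinuousLinearMap.orthogonalComplement_iSup_eigenspaces_eq_bot hc hS] at hSx
  simpa using hSx

theorem exists_isSingularExpansion_of_isCompactOperator [CompleteSpace F]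
    (hA : IsCompactOperator A) :
    ∃ (ι : Type u) (σ : ι → 𝕜) (f : ι → F) (e : ι → E), IsSingularExpansion A σ f e := by
  have hinner : ∀ x y, ⟪A x, A y⟫_𝕜 = ⟪x, (A.adjoint ∘L A) y⟫_𝕜 := fun x y => by
    rw [ContinuousLinearMap.comp_apply, ContinuousLinearMap.adjoint_inner_right]
  have hsymm : (A.adjoint ∘L A).IsSymmetric := fun x y => by
    simp [ContinuousLinearMap.adjoint_inner_left, ContinuousLinearMap.adjoint_inner_right]
  obtain ⟨ι, e, m, he, hm, heig, hker⟩ :=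
    exists_orthonormal_eigenvectors (hA.clm_comp A.adjoint) hsymm
  have hgram : ∀ i j, ⟪A (e i), A (e j)⟫_𝕜 = m j * ⟪e i, e j⟫_𝕜 := fun i j => by
    rw [hinner, heig, inner_smul_right]
  refine ⟨ι, _, _, e, isSingularExpansion_of_pairwise_inner_apply_eq_zero he (fun n h0 => ?_)
    (fun i j hij => by simp only [hgram, he.2 hij, mul_zero]) fun x hx => ?_⟩
  · have hnn := hgram n n
    rw [h0, inner_zero_left, inner_self_eq_norm_sq_to_K, he.1 n] at hnn
    exact hm n (by simpa using hnn.symm)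
  · have hmem : x ∈ (A.adjoint ∘L A).ker := hker x hx
    rwa [A.ker_adjoint_comp_self] at hmem

end SingularExpansion

section SquareIntegrable

variable {X ι : Type*} [MeasurableSpace X] {μ : Measure X} {f : ι → X → ℂ} {g : X → ℂ}

theorem sqNorm_eq_eLpNorm_sq (g : X → ℂ) : sqNorm μ g = eLpNorm g 2 μ ^ 2 := by
  simpa [sqNorm] using (eLpNorm_nnreal_pow_eq_lintegral (f := g) (μ := μ) (p := 2) two_ne_zero).symm

theorem sqNorm_eq_enorm_toLp_sq (hg : MemLp g 2 μ) : sqNorm μ g = ‖hg.toLp g‖ₑ ^ 2 := by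
  rw [sqNorm_eq_eLpNorm_sq, Lp.enorm_toLp]

theorem ip_eq_inner {a b : X → ℂ} (ha : MemLp a 2 μ) (hb : MemLp b 2 μ) :
    ip μ a b = ⟪hb.toLp b, ha.toLp a⟫_ℂ := by
  rw [L2.inner_def]
  refine integral_congr_ae ?_
  filter_upwards [ha.coeFn_toLp, hb.coeFn_toLp] with p hap hbp
  rw [hap, hbp, RCLike.inner_apply]

theorem memLp_conj (hg : MemLp g 2 μ) : MemLp (fun p => conj (g p)) 2 μ :=
  hg.star

theorem toLp_sum (hf : ∀ n, MemLp (f n) 2 μ) (F : Finset ι) :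
    (memLp_finsetSum F fun n _ => hf n).toLp (fun p => ∑ n ∈ F, f n p) =
      ∑ n ∈ F, (hf n).toLp (f n) := by
  refine Lp.ext ((MemLp.coeFn_toLp _).trans ?_)
  have hF : ∀ᵐ p ∂μ, ∀ n ∈ F, (hf n).toLp (f n) p = f n p :=
    F.eventually_all.2 fun n _ => (hf n).coeFn_toLp
  filter_upwards [Lp.coeFn_finsetSum F fun n => (hf n).toLp (f n), hF] with p hsum hp
  rw [hsum, Finset.sum_apply, Finset.sum_congr rfl hp]

theorem sqNorm_sub_sum (hf : ∀ n, MemLp (f n) 2 μ) (hg : MemLp g 2 μ) (F : Finset ι) :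
    sqNorm μ (fun p => g p - ∑ n ∈ F, f n p) =
      ‖hg.toLp g - ∑ n ∈ F, (hf n).toLp (f n)‖ₑ ^ 2 := by
  rw [← toLp_sum, ← MemLp.toLp_sub]
  exact sqNorm_eq_enorm_toLp_sq _

theorem tendsto_enorm_sq_zero_iff {α E : Type*} [SeminormedAddCommGroup E] {l : Filter α}
    {u : α → E} : Tendsto (fun a => ‖u a‖ₑ ^ 2) l (𝓝 0) ↔ Tendsto u l (𝓝 0) := by
  have henorm : Tendsto u l (𝓝 0) ↔ Tendsto (fun a => ‖u a‖ₑ) l (𝓝 0) := by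
    simp [tendsto_iff_edist_tendsto_0]
  have hsqrt : ∀ r : ℝ≥0∞, (r ^ 2) ^ (2⁻¹ : ℝ) = r := fun r =>
    mod_cast ENNReal.pow_rpow_inv_natCast two_ne_zero r
  rw [henorm]
  refine ⟨fun h => ?_, fun h => ?_⟩
  · simpa [hsqrt] using h.ennrpow_const 2⁻¹
  · simpa using h.ennrpow_const 2

theorem hasSumL2_iff (hf : ∀ n, MemLp (f n) 2 μ) (hg : MemLp g 2 μ) :
    HasSumL2 μ f g ↔ HasSum (fun n => (hf n).toLp (f n)) (hg.toLp g) := by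
  simp only [HasSumL2, sqNorm_sub_sum hf hg, tendsto_enorm_sq_zero_iff, HasSum,
    SummationFilter.unconditional_filter]
  refine ⟨fun h => ?_, fun h => ?_⟩ <;> simpa using h.const_sub (hg.toLp g)

theorem inClosedSpan_iff (hf : ∀ n, MemLp (f n) 2 μ) (hg : MemLp g 2 μ) :
    InClosedSpan μ f g ↔ hg.toLp g ∈
      (Submodule.span ℂ (Set.range fun n => (hf n).toLp (f n))).topologicalClosure := by
  have hdist : ∀ (F : Finset ι) (c : ι → ℂ), sqNorm μ (fun p => g p - ∑ n ∈ F, c n * f n p) =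
      edist (hg.toLp g) (∑ n ∈ F, c n • (hf n).toLp (f n)) ^ 2 := fun F c => by
    rw [edist_eq_enorm_sub]
    exact sqNorm_sub_sum (fun n => (hf n).const_smul (c n)) hg F
  rw [← SetLike.mem_coe, Submodule.topologicalClosure_coe, EMetric.mem_closure_iff]
  simp only [InClosedSpan, hdist]
  constructor
  · intro h ε hε
    obtain ⟨F, c, hFc⟩ := h (ε ^ 2) (by positivity)
    refine ⟨_, Submodule.sum_mem _ fun n _ => Submodule.smul_mem _ _ (Submodule.subset_span ?_),
      (ENNReal.pow_lt_pow_left_iff two_ne_zero).1 hFc⟩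
    exact ⟨n, rfl⟩
  · intro h ε hε
    have hsq : (ε ^ (2⁻¹ : ℝ)) ^ 2 = ε := mod_cast ENNReal.rpow_inv_natCast_pow two_ne_zero ε
    obtain ⟨y, hy, hlt⟩ := h (ε ^ (2⁻¹ : ℝ)) (ENNReal.rpow_pos_of_nonneg hε (by norm_num))
    obtain ⟨c, rfl⟩ := Finsupp.mem_span_range_iff_exists_finsupp.1 hy
    exact ⟨c.support, c, hsq ▸ (ENNReal.pow_lt_pow_left_iff two_ne_zero).2 hlt⟩

theorem IsOrthonormal.orthonormal_toLp (hf : IsOrthonormal μ f) :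
    Orthonormal ℂ fun n => (hf.memLp n).toLp (f n) := by
  classical
  refine orthonormal_iff_ite.2 fun i j => ?_
  rw [← ip_eq_inner (hf.memLp j) (hf.memLp i)]
  split_ifs with hij
  · rw [hij, hf.norm_one]
  · exact hf.orthogonal _ _ (Ne.symm hij)

theorem isOrthonormal_coeFn {v : ι → Lp ℂ 2 μ} (hv : Orthonormal ℂ v) :
    IsOrthonormal μ fun n => (v n : X → ℂ) := by
  classical
  have hip : ∀ n m, ip μ (v n) (v m) = if m = n then 1 else 0 := fun n m => by
    rw [ip_eq_inner (Lp.memLp (v n)) (Lp.memLp (v m)), Lp.toLp_coeFn, Lp.toLp_coeFn,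
      orthonormal_iff_ite.1 hv]
  exact ⟨fun n => Lp.memLp _, fun n => by simp [hip], fun n m hnm => by simp [hip, hnm.symm]⟩

theorem IsOrthonormal.conj (hf : IsOrthonormal μ f) :
    IsOrthonormal μ fun n p => conj (f n p) := by
  have hip : ∀ n m, ip μ (fun p => conj (f n p)) (fun p => conj (f m p)) = ip μ (f m) (f n) :=
    fun n m => by simp [ip, mul_comm]
  exact ⟨fun n => memLp_conj (hf.memLp n), fun n => by rw [hip, hf.norm_one],
    fun n m hnm => by rw [hip, hf.orthogonal _ _ hnm.symm]⟩

end SquareIntegrable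

section IntegralOperator

variable {X Y : Type*} [MeasurableSpace X] [MeasurableSpace Y] {μ : Measure X} {ν : Measure Y}
  {k : X → Y → ℂ} {x : Y → ℂ}

theorem memLp_mul_conj {a : X → ℂ} {b : Y → ℂ} (ha : MemLp a 2 μ) (hb : MemLp b 2 ν) :
    MemLp (fun z : X × Y => a z.1 * conj (b z.2)) 2 (μ.prod ν) := by
  have hmeas : AEStronglyMeasurable (fun z : X × Y => a z.1 * conj (b z.2)) (μ.prod ν) :=
    ha.1.comp_fst.mul (memLp_conj hb).1.comp_snd
  rw [memLp_two_iff_integrable_sq_norm hmeas]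
  simpa [mul_pow] using
    (ha.integrable_norm_pow two_ne_zero).mul_prod (hb.integrable_norm_pow two_ne_zero)

/-- The kernel `a(p) b(q)^*` of the rank-one operator `x ↦ ⟨b, x⟩ a`. The conjugate makes
`⟨rankOneKernel a b, K⟩` the matrix coefficient `⟨a, A b⟩` of the operator `A` with kernel `K`. -/
noncomputable def rankOneKernel (a : Lp ℂ 2 μ) (b : Lp ℂ 2 ν) : Lp ℂ 2 (μ.prod ν) :=
  (memLp_mul_conj (Lp.memLp a) (Lp.memLp b)).toLp _

theorem rankOneKernel_toLp {a : X → ℂ} {b : Y → ℂ} (ha : MemLp a 2 μ) (hb : MemLp b 2 ν) :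
    rankOneKernel (ha.toLp a) (hb.toLp b) = (memLp_mul_conj ha hb).toLp _ := by
  rw [rankOneKernel, MemLp.toLp_eq_toLp_iff]
  filter_upwards [Measure.quasiMeasurePreserving_fst.ae ha.coeFn_toLp,
    Measure.quasiMeasurePreserving_snd.ae hb.coeFn_toLp] with z haz hbz
  rw [haz, hbz]

theorem rankOneKernel_add_right (a : Lp ℂ 2 μ) (b b' : Lp ℂ 2 ν) :
    rankOneKernel a (b + b') = rankOneKernel a b + rankOneKernel a b' := by
  rw [rankOneKernel, rankOneKernel, rankOneKernel, ← MemLp.toLp_add, MemLp.toLp_eq_toLp_iff]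
  filter_upwards [Measure.quasiMeasurePreserving_snd.ae (Lp.coeFn_add b b')] with z hz
  simp only [hz, Pi.add_apply, map_add, mul_add]

theorem rankOneKernel_smul_right (c : ℂ) (a : Lp ℂ 2 μ) (b : Lp ℂ 2 ν) :
    rankOneKernel a (c • b) = conj c • rankOneKernel a b := by
  rw [rankOneKernel, rankOneKernel, ← MemLp.toLp_const_smul, MemLp.toLp_eq_toLp_iff]
  filter_upwards [Measure.quasiMeasurePreserving_snd.ae (Lp.coeFn_smul c b)] with z hz
  simp only [hz, Pi.smul_apply, smul_eq_mul, map_mul, mul_left_comm]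

theorem enorm_channel_sq_le {X : Type*} {k : X → Y → ℂ} {p : X} (hp : MemLp (k p) 2 ν)
    (hx : MemLp x 2 ν) :
    ‖channel ν k x p‖ₑ ^ 2 ≤ sqNorm ν (k p) * sqNorm ν x := by
  rw [sqNorm_eq_eLpNorm_sq, sqNorm_eq_eLpNorm_sq, ← mul_pow]
  gcongr
  have hholder := eLpNorm_smul_le_mul_eLpNorm (r := 1) (p := 2) (q := 2) hx.1 hp.1
  rw [eLpNorm_one_eq_lintegral_enorm] at hholder
  exact (enorm_integral_le_lintegral_enorm _).trans hholder

variable [SFinite ν]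

theorem channel_congr_ae {k' : X → Y → ℂ} {x' : Y → ℂ}
    (hk : (fun z : X × Y => k z.1 z.2) =ᵐ[μ.prod ν] fun z => k' z.1 z.2) (hx : x =ᵐ[ν] x') :
    channel ν k x =ᵐ[μ] channel ν k' x' := by
  filter_upwards [Measure.ae_ae_of_ae_prod hk] with p hp
  refine integral_congr_ae ?_
  filter_upwards [hp, hx] with q hkq hxq
  rw [hxq]
  exact congrArg (· * x' q) hkq

variable [SFinite μ]

theorem inner_rankOneKernel_rankOneKernel (a a' : Lp ℂ 2 μ) (b b' : Lp ℂ 2 ν) :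
    ⟪rankOneKernel a b, rankOneKernel a' b'⟫_ℂ = ⟪a, a'⟫_ℂ * ⟪b', b⟫_ℂ := by
  rw [rankOneKernel, rankOneKernel, ← ip_eq_inner, L2.inner_def, L2.inner_def,
    ← integral_prod_mul, ip]
  congr 1 with z
  simp only [RCLike.inner_apply, map_mul, Complex.conj_conj]
  ring

theorem ae_memLp_kernel (hk : MemLp (fun z : X × Y => k z.1 z.2) 2 (μ.prod ν)) :
    ∀ᵐ p ∂μ, MemLp (k p) 2 ν := by
  filter_upwards [hk.1.prodMk_left, (hk.integrable_norm_pow two_ne_zero).prod_right_ae]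
    with p hmeas hint
  exact (memLp_two_iff_integrable_sq_norm hmeas).2 hint

theorem ae_integrable_kernel_mul (hk : MemLp (fun z : X × Y => k z.1 z.2) 2 (μ.prod ν))
    (hx : MemLp x 2 ν) : ∀ᵐ p ∂μ, Integrable (fun q => k p q * x q) ν := by
  filter_upwards [ae_memLp_kernel hk] with p hp
  exact hp.integrable_mul hx

theorem sqNorm_channel_le (hk : MemLp (fun z : X × Y => k z.1 z.2) 2 (μ.prod ν))
    (hx : MemLp x 2 ν) :
    sqNorm μ (channel ν k x) ≤ sqNorm (μ.prod ν) (fun z => k z.1 z.2) * sqNorm ν x := by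
  have hmeas : AEMeasurable (fun z : X × Y => ‖k z.1 z.2‖ₑ ^ 2) (μ.prod ν) :=
    hk.1.enorm.pow_const 2
  calc sqNorm μ (channel ν k x)
      ≤ ∫⁻ p, sqNorm ν (k p) * sqNorm ν x ∂μ :=
        lintegral_mono_ae ((ae_memLp_kernel hk).mono fun p hp => enorm_channel_sq_le hp hx)
    _ = (∫⁻ p, sqNorm ν (k p) ∂μ) * sqNorm ν x :=
        lintegral_mul_const'' _ hmeas.lintegral_prod_right'
    _ = sqNorm (μ.prod ν) (fun z => k z.1 z.2) * sqNorm ν x :=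
        congrArg (· * sqNorm ν x) (lintegral_prod _ hmeas).symm

theorem memLp_channel (hk : MemLp (fun z : X × Y => k z.1 z.2) 2 (μ.prod ν)) (hx : MemLp x 2 ν) :
    MemLp (channel ν k x) 2 μ := by
  refine ⟨(hk.1.mul hx.1.comp_snd).integral_prod_right', ?_⟩
  have hfin := (sqNorm_channel_le hk hx).trans_lt <| by
    rw [sqNorm_eq_eLpNorm_sq, sqNorm_eq_eLpNorm_sq]
    exact ENNReal.mul_lt_top (ENNReal.pow_lt_top hk.2) (ENNReal.pow_lt_top hx.2)
  rw [sqNorm_eq_eLpNorm_sq] at hfin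
  exact (ENNReal.pow_lt_top_iff.1 hfin).resolve_right two_ne_zero

theorem memLp_channel_coeFn (K : Lp ℂ 2 (μ.prod ν)) (b : Lp ℂ 2 ν) :
    MemLp (channel ν (fun p q => K (p, q)) b) 2 μ :=
  memLp_channel (k := fun p q => K (p, q)) (Lp.memLp K) (Lp.memLp b)

theorem inner_toLp_channel (K : Lp ℂ 2 (μ.prod ν)) (a : Lp ℂ 2 μ) (b : Lp ℂ 2 ν) :
    ⟪a, (memLp_channel_coeFn K b).toLp _⟫_ℂ = ⟪rankOneKernel a b, K⟫_ℂ := by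
  have hint : Integrable (fun z : X × Y => K z * conj (a z.1 * conj (b z.2))) (μ.prod ν) :=
    (Lp.memLp K).integrable_mul (memLp_conj (memLp_mul_conj (Lp.memLp a) (Lp.memLp b)))
  have ha := ip_eq_inner (memLp_channel_coeFn K b) (Lp.memLp a)
  have hK := ip_eq_inner (Lp.memLp K) (memLp_mul_conj (Lp.memLp a) (Lp.memLp b))
  rw [Lp.toLp_coeFn] at ha hK
  rw [← ha, rankOneKernel, ← hK, ip, ip, integral_prod _ hint]
  congr 1 with p
  rw [channel, ← integral_mul_const]
  congr 1 with q
  simp only [map_mul, Complex.conj_conj]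
  ring

theorem norm_toLp_channel_le (K : Lp ℂ 2 (μ.prod ν)) (b : Lp ℂ 2 ν) :
    ‖(memLp_channel_coeFn K b).toLp _‖ ≤ ‖K‖ * ‖b‖ := by
  have hsq := sqNorm_channel_le (k := fun p q => K (p, q)) (Lp.memLp K) (Lp.memLp b)
  simp only [sqNorm_eq_eLpNorm_sq, ← mul_pow, ENNReal.pow_le_pow_left_iff two_ne_zero] at hsq
  rw [Lp.norm_toLp, Lp.norm_def, Lp.norm_def, ← ENNReal.toReal_mul]
  exact ENNReal.toReal_mono (ENNReal.mul_ne_top (Lp.memLp K).2.ne (Lp.memLp b).2.ne) hsq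

/-- The operator `L²(ν) → L²(μ)` with a given kernel, as a bounded bilinear map. -/
noncomputable def kernelOp : Lp ℂ 2 (μ.prod ν) →L[ℂ] Lp ℂ 2 ν →L[ℂ] Lp ℂ 2 μ :=
  LinearMap.mkContinuous₂
    (LinearMap.mk₂ ℂ (fun K b => (memLp_channel_coeFn K b).toLp _)
      (fun K K' b => ext_inner_left ℂ fun a => by
        simp only [inner_add_right, inner_toLp_channel])
      (fun c K b => ext_inner_left ℂ fun a => by
        simp only [inner_smul_right, inner_toLp_channel])
      (fun K b b' => ext_inner_left ℂ fun a => by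
        simp only [inner_add_right, inner_toLp_channel, rankOneKernel_add_right, inner_add_left])
      (fun c K b => ext_inner_left ℂ fun a => by
        simp only [inner_smul_right, inner_toLp_channel, rankOneKernel_smul_right,
          inner_smul_left, Complex.conj_conj]))
    1 fun K b => by simpa using norm_toLp_channel_le K b

theorem kernelOp_toLp (hk : MemLp (fun z : X × Y => k z.1 z.2) 2 (μ.prod ν)) (hx : MemLp x 2 ν) :
    kernelOp (hk.toLp _) (hx.toLp x) = (memLp_channel hk hx).toLp _ :=
  (MemLp.toLp_eq_toLp_iff (memLp_channel_coeFn _ _) _).2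
    (channel_congr_ae (k := fun p q => hk.toLp (fun z : X × Y => k z.1 z.2) (p, q))
      hk.coeFn_toLp hx.coeFn_toLp)

theorem inner_kernelOp (K : Lp ℂ 2 (μ.prod ν)) (a : Lp ℂ 2 μ) (b : Lp ℂ 2 ν) :
    ⟪a, kernelOp K b⟫_ℂ = ⟪rankOneKernel a b, K⟫_ℂ :=
  inner_toLp_channel K a b

theorem kernelOp_rankOneKernel (a : Lp ℂ 2 μ) (b : Lp ℂ 2 ν) :
    kernelOp (rankOneKernel a b) = InnerProductSpace.rankOne ℂ a b :=
  ContinuousLinearMap.ext fun x => ext_inner_left ℂ fun c => by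
    rw [inner_kernelOp, inner_rankOneKernel_rankOneKernel, InnerProductSpace.rankOne_apply,
      inner_smul_right, mul_comm]

end IntegralOperator

section Density

theorem ae_eq_zero_of_forall_setIntegral_piSystem_eq_zero {Z E : Type*} {m : MeasurableSpace Z}
    {μ : Measure Z} [NormedAddCommGroup E] [NormedSpace ℝ E] [CompleteSpace E]
    {C : Set (Set Z)} (hC : IsPiSystem C) (hm : m = MeasurableSpace.generateFrom C) {f : Z → E}
    (hf : Integrable f μ) (huniv : ∫ z, f z ∂μ = 0) (hzero : ∀ s ∈ C, ∫ z in s, f z ∂μ = 0) :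
    f =ᵐ[μ] 0 := by
  suffices hmeas : ∀ s, MeasurableSet s → ∫ z in s, f z ∂μ = 0 from
    hf.ae_eq_zero_of_forall_setIntegral_eq_zero fun s hs _ => hmeas s hs
  intro s hs
  induction s, hs using MeasurableSpace.induction_on_inter hm hC with
  | empty => simp
  | basic s hs => exact hzero s hs
  | compl s hs ih =>
    rwa [← integral_add_compl hs hf, ih, zero_add] at huniv
  | iUnion s hdisj hs ih =>
    rw [integral_iUnion hs hdisj hf.integrableOn]
    simp [ih]

variable {X Y : Type*} [MeasurableSpace X] [MeasurableSpace Y] {μ : Measure X} {ν : Measure Y}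

theorem mul_conj_ae_eq_zero_of_forall_inner_rankOneKernel_eq_zero {K : Lp ℂ 2 (μ.prod ν)}
    (hK : ∀ a b, ⟪rankOneKernel a b, K⟫_ℂ = 0) {a : X → ℂ} {b : Y → ℂ}
    (ha : MemLp a 2 μ) (hb : MemLp b 2 ν) :
    ∀ᵐ z ∂μ.prod ν, K z * conj (a z.1 * conj (b z.2)) = 0 := by
  have hint : Integrable (fun z : X × Y => K z * conj (a z.1 * conj (b z.2))) (μ.prod ν) :=
    (Lp.memLp K).integrable_mul (memLp_conj (memLp_mul_conj ha hb))
  have hrect : ∀ {S : Set X} {T : Set Y}, MeasurableSet S → MeasurableSet T →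
      ∫ z in S ×ˢ T, K z * conj (a z.1 * conj (b z.2)) ∂μ.prod ν = 0 := by
    intro S T hS hT
    have hip := hK ((ha.indicator hS).toLp _) ((hb.indicator hT).toLp _)
    rw [rankOneKernel_toLp, ← Lp.toLp_coeFn K (Lp.memLp K), ← ip_eq_inner, ip] at hip
    rw [← integral_indicator (hS.prod hT), ← hip]
    congr 1 with z
    by_cases hzS : z.1 ∈ S <;> by_cases hzT : z.2 ∈ T <;> simp [Set.indicator, hzS, hzT]
  refine ae_eq_zero_of_forall_setIntegral_piSystem_eq_zero isPiSystem_prod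
    generateFrom_prod.symm hint ?_ ?_
  · simpa using hrect .univ .univ
  · rintro _ ⟨S, hS, T, hT, rfl⟩
    exact hrect hS hT

variable [SFinite μ] [SFinite ν]

theorem exists_memLp_ae_fst_eq_zero_imp {k : X × Y → ℂ} (hkm : StronglyMeasurable k)
    (hk : MemLp k 2 (μ.prod ν)) :
    ∃ a : X → ℂ, MemLp a 2 μ ∧ ∀ᵐ z ∂μ.prod ν, a z.1 = 0 → k z = 0 := by
  have hsq : StronglyMeasurable fun z => ‖k z‖ ^ 2 := hkm.norm.pow 2
  have hint : Integrable (fun z => ‖k z‖ ^ 2) (μ.prod ν) := hk.integrable_norm_pow two_ne_zero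
  let E : X → ℝ := fun p => ∫ q, ‖k (p, q)‖ ^ 2 ∂ν
  have hE : Measurable E := hsq.integral_prod_right'.measurable
  have hE0 : ∀ p, 0 ≤ E p := fun p => integral_nonneg fun q => by positivity
  refine ⟨fun p => (√(E p) : ℂ), ?_, ?_⟩
  · rw [memLp_two_iff_integrable_sq_norm (by fun_prop)]
    simpa [Real.sq_sqrt (hE0 _)] using hint.integral_prod_left
  · rw [Measure.ae_prod_iff_ae_ae]
    · filter_upwards [hint.prod_right_ae] with p hp
      by_cases hEp : E p = 0
      · filter_upwards [(integral_eq_zero_iff_of_nonneg (fun q => by positivity) hp).1 hEp]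
          with q hq _
        simpa using hq
      · simp [Real.sqrt_eq_zero (hE0 p), hEp]
    · have ha : Measurable fun z : X × Y => (√(E z.1) : ℂ) := by fun_prop
      exact (ha (measurableSet_singleton 0)).imp (hkm.measurable (measurableSet_singleton 0))

-- Weights `a` and `b` vanishing only where `K` does replace a localisation to finite measure.
theorem eq_zero_of_forall_inner_rankOneKernel_eq_zero {K : Lp ℂ 2 (μ.prod ν)}
    (hK : ∀ a b, ⟪rankOneKernel a b, K⟫_ℂ = 0) : K = 0 := by
  have hswap : MeasurePreserving Prod.swap (ν.prod μ) (μ.prod ν) := Measure.measurePreserving_swap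
  have hKm := Lp.stronglyMeasurable K
  obtain ⟨a, ha, haK⟩ := exists_memLp_ae_fst_eq_zero_imp hKm (Lp.memLp K)
  obtain ⟨b, hb, hbK⟩ := exists_memLp_ae_fst_eq_zero_imp
    (hKm.comp_measurable measurable_swap) ((Lp.memLp K).comp_measurePreserving hswap)
  have hbK' : ∀ᵐ z ∂μ.prod ν, b z.2 = 0 → K z = 0 :=
    Measure.measurePreserving_swap.quasiMeasurePreserving.ae hbK
  refine Lp.eq_zero_iff_ae_eq_zero.2 ?_
  filter_upwards [mul_conj_ae_eq_zero_of_forall_inner_rankOneKernel_eq_zero hK ha hb, haK, hbK']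
    with z hz haz hbz
  simp only [mul_eq_zero, map_eq_zero] at hz
  exact hz.elim id (Or.elim · haz hbz)

theorem kernelOp_injective :
    Function.Injective (kernelOp : Lp ℂ 2 (μ.prod ν) →L[ℂ] Lp ℂ 2 ν →L[ℂ] Lp ℂ 2 μ) := by
  refine (injective_iff_map_eq_zero _).2 fun K hK => ?_
  exact eq_zero_of_forall_inner_rankOneKernel_eq_zero fun a b => by simp [← inner_kernelOp, hK]

theorem isCompactOperator_kernelOp (K : Lp ℂ 2 (μ.prod ν)) : IsCompactOperator (kernelOp K) := by
  let V : Submodule ℂ (Lp ℂ 2 (μ.prod ν)) :=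
    (compactOperator (RingHom.id ℂ) (Lp ℂ 2 ν) (Lp ℂ 2 μ)).comap kernelOp.toLinearMap
  have hclosed : IsClosed (V : Set (Lp ℂ 2 (μ.prod ν))) :=
    isClosed_setOfPred_isCompactOperator.preimage kernelOp.continuous
  have hcomplete : CompleteSpace V := hclosed.completeSpace_coe
  have hrank : ∀ a b, rankOneKernel a b ∈ V := fun a b => by
    change IsCompactOperator (kernelOp (rankOneKernel a b))
    rw [kernelOp_rankOneKernel, InnerProductSpace.rankOne_def']
    exact (isCompactOperator_of_locallyCompactSpace_rng
      (ContinuousLinearMap.toSpanSingleton ℂ a)).comp_clm (innerSL ℂ b)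
  have htop : V = ⊤ := by
    rw [← Submodule.orthogonal_eq_bot_iff, Submodule.eq_bot_iff]
    exact fun L hL =>
      eq_zero_of_forall_inner_rankOneKernel_eq_zero fun a b => hL _ (hrank a b)
  exact htop.ge Submodule.mem_top

end Density

section Decomposition

variable {X Y ι : Type*} [MeasurableSpace X] [MeasurableSpace Y] {μ : Measure X} {ν : Measure Y}

section KernelExpansion

variable [SFinite μ] [SFinite ν] {K : Lp ℂ 2 (μ.prod ν)} {σ : ι → ℂ} {f : ι → Lp ℂ 2 μ}
  {e : ι → Lp ℂ 2 ν}

theorem orthonormal_rankOneKernel (hf : Orthonormal ℂ f) (he : Orthonormal ℂ e) :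
    Orthonormal ℂ fun n => rankOneKernel (f n) (e n) := by
  classical
  refine orthonormal_iff_ite.2 fun i j => ?_
  rw [inner_rankOneKernel_rankOneKernel, orthonormal_iff_ite.1 hf, orthonormal_iff_ite.1 he]
  by_cases hij : i = j <;> simp [hij]

theorem hasSum_kernelOp_apply (hK : HasSum (fun n => σ n • rankOneKernel (f n) (e n)) K)
    (x : Lp ℂ 2 ν) : HasSum (fun n => (σ n * ⟪e n, x⟫_ℂ) • f n) (kernelOp K x) := by
  simpa [kernelOp_rankOneKernel, smul_smul] using
    (hK.mapL kernelOp).mapL (ContinuousLinearMap.apply ℂ (Lp ℂ 2 μ) x)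

theorem IsSingularExpansion.hasSum_rankOneKernel (h : IsSingularExpansion (kernelOp K) σ f e) :
    HasSum (fun n => σ n • rankOneKernel (f n) (e n)) K := by
  have hcoeff : ∀ n, ⟪rankOneKernel (f n) (e n), K⟫_ℂ = σ n := fun n => by
    rw [← inner_kernelOp, h.inner_apply, inner_self_eq_norm_sq_to_K, h.orthonormal_right.1 n]
    simp
  obtain ⟨L, hL⟩ :=
    summable_inner_smul (orthonormal_rankOneKernel h.orthonormal_left h.orthonormal_right) K
  simp only [hcoeff] at hL
  have hLK : L = K := kernelOp_injective <| ContinuousLinearMap.ext fun x =>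
    (hasSum_kernelOp_apply hL x).unique (h.hasSum x)
  exact hLK ▸ hL

theorem IsSingularExpansion.countable (h : IsSingularExpansion (kernelOp K) σ f e) :
    Countable ι := by
  have hsupp : (fun n => σ n • rankOneKernel (f n) (e n)).support = Set.univ :=
    Set.eq_univ_of_forall fun n => smul_ne_zero (h.ne_zero n)
      ((orthonormal_rankOneKernel h.orthonormal_left h.orthonormal_right).ne_zero n)
  exact Set.countable_univ_iff.1 (hsupp ▸ h.hasSum_rankOneKernel.summable.countable_support)

theorem exists_isSingularExpansion_kernelOp (K : Lp ℂ 2 (μ.prod ν)) :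
    ∃ (I : Set ℕ) (σ : I → ℂ) (f : I → Lp ℂ 2 μ) (e : I → Lp ℂ 2 ν),
      IsSingularExpansion (kernelOp K) σ f e := by
  obtain ⟨ι, σ, f, e, h⟩ :=
    exists_isSingularExpansion_of_isCompactOperator (isCompactOperator_kernelOp K)
  have hι : Countable ι := h.countable
  obtain ⟨u, hu⟩ := exists_injective_nat ι
  exact ⟨Set.range u, _, _, _, h.comp_equiv (Equiv.ofInjective u hu).symm⟩

end KernelExpansion

variable {k : X → Y → ℂ} {σ : ι → ℂ} {ψ : ι → X → ℂ} {φ : ι → Y → ℂ} {s : X → ℂ} {x : Y → ℂ}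

theorem hasSumL2_kernel_iff (hk : MemLp (fun z : X × Y => k z.1 z.2) 2 (μ.prod ν))
    (hψ : ∀ n, MemLp (ψ n) 2 μ) (hφ : ∀ n, MemLp (φ n) 2 ν) :
    HasSumL2 (μ.prod ν) (fun n (z : X × Y) => σ n * ψ n z.1 * φ n z.2) (fun z => k z.1 z.2) ↔
      HasSum (fun n => σ n • rankOneKernel ((hψ n).toLp (ψ n)) ((memLp_conj (hφ n)).toLp _))
        (hk.toLp _) := by
  have hfun : (fun n (z : X × Y) => σ n * ψ n z.1 * φ n z.2) =
      fun n => σ n • fun z : X × Y => ψ n z.1 * conj (conj (φ n z.2)) := by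
    ext n z
    simp [mul_assoc]
  rw [hfun,
    hasSumL2_iff (fun n => (memLp_mul_conj (hψ n) (memLp_conj (hφ n))).const_smul (σ n)) hk]
  simp only [rankOneKernel_toLp]
  rfl

theorem exists_isDecomposition [SFinite μ] [SFinite ν]
    (hk : MemLp (fun z : X × Y => k z.1 z.2) 2 (μ.prod ν)) :
    ∃ (I : Set ℕ) (σ : I → ℂ) (ψ : I → X → ℂ) (φ : I → Y → ℂ), IsDecomposition μ ν k σ ψ φ := by
  obtain ⟨I, σ, f, e, h⟩ := exists_isSingularExpansion_kernelOp (hk.toLp _)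
  refine ⟨I, σ, fun n => f n, fun n q => conj (e n q), h.ne_zero,
    isOrthonormal_coeFn h.orthonormal_left, (isOrthonormal_coeFn h.orthonormal_right).conj, ?_⟩
  rw [hasSumL2_kernel_iff hk (fun n => Lp.memLp (f n)) fun n => memLp_conj (Lp.memLp (e n))]
  simpa only [Complex.conj_conj, Lp.toLp_coeFn] using h.hasSum_rankOneKernel

theorem sqNorm_sub_channel [SFinite μ] [SFinite ν]
    (hk : MemLp (fun z : X × Y => k z.1 z.2) 2 (μ.prod ν)) (hs : MemLp s 2 μ) (hx : MemLp x 2 ν) :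
    sqNorm μ (fun p => s p - channel ν k x p) =
      ‖hs.toLp s - kernelOp (hk.toLp _) (hx.toLp x)‖ₑ ^ 2 := by
  rw [kernelOp_toLp, ← MemLp.toLp_sub]
  exact sqNorm_eq_enorm_toLp_sq _

theorem sqNorm_sub_channel_eq_zero_iff [SFinite μ] [SFinite ν]
    (hk : MemLp (fun z : X × Y => k z.1 z.2) 2 (μ.prod ν)) (hs : MemLp s 2 μ) (hx : MemLp x 2 ν) :
    sqNorm μ (fun p => s p - channel ν k x p) = 0 ↔
      kernelOp (hk.toLp _) (hx.toLp x) = hs.toLp s := by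
  rw [sqNorm_sub_channel hk hs hx, pow_eq_zero_iff two_ne_zero, enorm_eq_zero, sub_eq_zero,
    eq_comm]

namespace IsDecomposition

theorem memLp_precodedTerm (d : IsDecomposition μ ν k σ ψ φ) (s : X → ℂ) (n : ι) :
    MemLp (precodedTerm μ σ ψ φ s n) 2 ν :=
  (d.orthonormal_in.conj.memLp n).const_mul _

theorem toLp_precodedTerm (d : IsDecomposition μ ν k σ ψ φ) (hs : MemLp s 2 μ) (n : ι) :
    (d.memLp_precodedTerm s n).toLp _ =
      (⟪(d.orthonormal_out.memLp n).toLp (ψ n), hs.toLp s⟫_ℂ / σ n) •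
        (d.orthonormal_in.conj.memLp n).toLp _ := by
  rw [← ip_eq_inner hs (d.orthonormal_out.memLp n), ← MemLp.toLp_const_smul]
  rfl

theorem isPrecoded_iff (d : IsDecomposition μ ν k σ ψ φ) (hs : MemLp s 2 μ) (hx : MemLp x 2 ν) :
    IsPrecoded μ ν σ ψ φ s x ↔
      HasSum (fun n => (⟪(d.orthonormal_out.memLp n).toLp (ψ n), hs.toLp s⟫_ℂ / σ n) •
        (d.orthonormal_in.conj.memLp n).toLp _) (hx.toLp x) := by
  simp only [← d.toLp_precodedTerm hs]
  rw [← hasSumL2_iff (d.memLp_precodedTerm s) hx]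
  exact ⟨fun h => h.hasSum, fun h => ⟨hx, h⟩⟩

variable [SFinite μ] [SFinite ν]

theorem isSingularExpansion_kernelOp (d : IsDecomposition μ ν k σ ψ φ)
    (hk : MemLp (fun z : X × Y => k z.1 z.2) 2 (μ.prod ν)) :
    IsSingularExpansion (kernelOp (hk.toLp _)) σ
      (fun n => (d.orthonormal_out.memLp n).toLp (ψ n))
      (fun n => (d.orthonormal_in.conj.memLp n).toLp _) where
  ne_zero := d.ne_zero
  orthonormal_left := d.orthonormal_out.orthonormal_toLp
  orthonormal_right := d.orthonormal_in.conj.orthonormal_toLp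
  hasSum := hasSum_kernelOp_apply <|
    (hasSumL2_kernel_iff hk d.orthonormal_out.memLp d.orthonormal_in.memLp).1 d.hasSum

theorem sqNorm_sub_channel_eq_zero (d : IsDecomposition μ ν k σ ψ φ)
    (hk : MemLp (fun z : X × Y => k z.1 z.2) 2 (μ.prod ν)) (hs : MemLp s 2 μ)
    (hspan : InClosedSpan μ ψ s) (hx : IsPrecoded μ ν σ ψ φ s x) :
    sqNorm μ (fun p => s p - channel ν k x p) = 0 :=
  (sqNorm_sub_channel_eq_zero_iff hk hs hx.memLp).2 <|
    (d.isSingularExpansion_kernelOp hk).apply_eq_of_hasSum_inner_div_smul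
      ((inClosedSpan_iff d.orthonormal_out.memLp hs).1 hspan) ((d.isPrecoded_iff hs hx.memLp).1 hx)

theorem exists_sqNorm_sub_channel_eq_zero_iff (d : IsDecomposition μ ν k σ ψ φ)
    (hk : MemLp (fun z : X × Y => k z.1 z.2) 2 (μ.prod ν)) (hs : MemLp s 2 μ) :
    (∃ y : Y → ℂ, MemLp y 2 ν ∧ sqNorm μ (fun p => s p - channel ν k y p) = 0) ↔
      InClosedSpan μ ψ s ∧ ∃ x : Y → ℂ, IsPrecoded μ ν σ ψ φ s x := by
  have h := d.isSingularExpansion_kernelOp hk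
  constructor
  · rintro ⟨y, hy, hzero⟩
    rw [sqNorm_sub_channel_eq_zero_iff hk hs hy] at hzero
    refine ⟨(inClosedSpan_iff d.orthonormal_out.memLp hs).2 ?_, ?_⟩
    · exact hzero ▸ h.apply_mem_topologicalClosure_span _
    · obtain ⟨x, hx⟩ := h.summable_inner_apply_div_smul (hy.toLp y)
      rw [hzero, ← Lp.toLp_coeFn x (Lp.memLp x)] at hx
      exact ⟨x, (d.isPrecoded_iff hs (Lp.memLp x)).2 hx⟩
  · rintro ⟨hspan, x, hx⟩
    exact ⟨x, hx.memLp, d.sqNorm_sub_channel_eq_zero hk hs hspan hx⟩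

theorem tendsto_sqNorm_sub_channel_sum (d : IsDecomposition μ ν k σ ψ φ)
    (hk : MemLp (fun z : X × Y => k z.1 z.2) 2 (μ.prod ν)) (hs : MemLp s 2 μ)
    (hspan : InClosedSpan μ ψ s) :
    Tendsto (fun F : Finset ι => sqNorm μ (fun p => s p -
      channel ν k (fun q => ∑ n ∈ F, precodedTerm μ σ ψ φ s n q) p)) atTop (𝓝 0) := by
  have hmem := d.memLp_precodedTerm s
  simp only [fun F : Finset ι => sqNorm_sub_channel hk hs (memLp_finsetSum F fun n _ => hmem n),
    toLp_sum hmem, d.toLp_precodedTerm hs, map_sum, tendsto_enorm_sq_zero_iff]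
  have hsum := (d.isSingularExpansion_kernelOp hk).hasSum_apply_inner_div_smul
    ((inClosedSpan_iff d.orthonormal_out.memLp hs).1 hspan)
  simpa using Tendsto.const_sub (hs.toLp s) hsum

end IsDecomposition

end Decomposition

end Precoding

theorem theorem2_general {X Y : Type*} [MeasurableSpace X] [MeasurableSpace Y]
    (μ : Measure X) (ν : Measure Y) [SFinite μ] [SFinite ν] (k : X → Y → ℂ)
    (hk : MemLp (fun z : X × Y => k z.1 z.2) 2 (μ.prod ν)) :
    (∃ (I : Set ℕ) (σ : I → ℂ) (ψ : I → X → ℂ) (φ : I → Y → ℂ),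
      Precoding.IsDecomposition μ ν k σ ψ φ) ∧
    ∀ {ι : Type*} (σ : ι → ℂ) (ψ : ι → X → ℂ) (φ : ι → Y → ℂ),
      Precoding.IsDecomposition μ ν k σ ψ φ → ∀ s : X → ℂ, MemLp s 2 μ →
        (Precoding.InClosedSpan μ ψ s → ∀ x : Y → ℂ, Precoding.IsPrecoded μ ν σ ψ φ s x →
          (∀ᵐ p ∂μ, Integrable (fun q => k p q * x q) ν) ∧
          Precoding.sqNorm μ (fun p => s p - Precoding.channel ν k x p) = 0) ∧
        ((∃ y : Y → ℂ, MemLp y 2 ν ∧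
            Precoding.sqNorm μ (fun p => s p - Precoding.channel ν k y p) = 0) ↔
          Precoding.InClosedSpan μ ψ s ∧ ∃ x : Y → ℂ, Precoding.IsPrecoded μ ν σ ψ φ s x) ∧
        (Precoding.InClosedSpan μ ψ s →
          Tendsto (fun F : Finset ι => Precoding.sqNorm μ (fun p => s p -
            Precoding.channel ν k (fun q => ∑ n ∈ F, Precoding.precodedTerm μ σ ψ φ s n q) p))
            atTop (𝓝 0)) :=
  ⟨Precoding.exists_isDecomposition hk, fun _ _ _ d _ hs =>
    ⟨fun hspan _ hx => ⟨Precoding.ae_integrable_kernel_mul hk hx.memLp,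
      d.sqNorm_sub_channel_eq_zero hk hs hspan hx⟩,
    d.exists_sqNorm_sub_channel_eq_zero_iff hk hs, d.tendsto_sqNorm_sub_channel_sum hk hs⟩⟩

theorem theorem2
    {U T U' T' : Type*} [MeasurableSpace U] [MeasurableSpace T]
    [MeasurableSpace U'] [MeasurableSpace T']
    (μU : Measure U) (μT : Measure T) (νU : Measure U') (νT : Measure T')
    [SigmaFinite μU] [SigmaFinite μT] [SigmaFinite νU] [SigmaFinite νT]
    (k : U × T → U' × T' → ℂ)
    (hk : MemLp (fun z : (U × T) × (U' × T') => k z.1 z.2) 2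
      ((μU.prod μT).prod (νU.prod νT))) :
    -- the kernel has a decomposition (`I` is finite if the kernel has finite rank)
    (∃ (I : Set ℕ) (σ : I → ℂ) (ψ : I → U × T → ℂ) (φ : I → U' × T' → ℂ),
      Precoding.IsDecomposition (μU.prod μT) (νU.prod νT) k σ ψ φ) ∧
    -- and every decomposition yields an interference-free precoding
    ∀ (I : Set ℕ) (σ : I → ℂ) (ψ : I → U × T → ℂ) (φ : I → U' × T' → ℂ),
      Precoding.IsDecomposition (μU.prod μT) (νU.prod νT) k σ ψ φ →
      ∀ s : U × T → ℂ, MemLp s 2 (μU.prod μT) →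
        -- the precoded signal gives interference-free reception
        (Precoding.InClosedSpan (μU.prod μT) ψ s →
          ∀ x : U' × T' → ℂ,
            Precoding.IsPrecoded (μU.prod μT) (νU.prod νT) σ ψ φ s x →
            (∀ᵐ p ∂(μU.prod μT), Integrable (fun q => k p q * x q) (νU.prod νT)) ∧
            Precoding.sqNorm (μU.prod μT)
              (fun p => s p - Precoding.channel (νU.prod νT) k x p) = 0) ∧
        -- it exists whenever any transmit signal of finite energy is received without error
        ((∃ y : U' × T' → ℂ, MemLp y 2 (νU.prod νT) ∧
            Precoding.sqNorm (μU.prod μT)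
              (fun p => s p - Precoding.channel (νU.prod νT) k y p) = 0) ↔
          Precoding.InClosedSpan (μU.prod μT) ψ s ∧
            ∃ x : U' × T' → ℂ,
              Precoding.IsPrecoded (μU.prod μT) (νU.prod νT) σ ψ φ s x) ∧
        -- and in any case the error of its partial sums tends to zero
        (Precoding.InClosedSpan (μU.prod μT) ψ s →
          Tendsto (fun F : Finset I =>
            Precoding.sqNorm (μU.prod μT) (fun p => s p -
              Precoding.channel (νU.prod νT) k
                (fun q => ∑ n ∈ F, Precoding.precodedTerm (μU.prod μT) σ ψ φ s n q) p))
            atTop (𝓝 0)) :=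
  have h := theorem2_general (μU.prod μT) (νU.prod νT) k hk
  ⟨h.1, fun _ => h.2⟩
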